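/- Let $X$ be a path-connected and locally path-connected topological space and let $\mathcal C(X)$ be the ring of continuous functions $X\to\mathbb C$. A Weierstrass polynomial of degree $n$ on $X$ is a monic $f\in\mathcal C(X)[z]$ of degree $n$ such that for every $x\in X$ the polynomial $f_x\in\mathbb C[z]$ has $n$ distinct roots. For a covering $p:Y\to X$ let $p^*f\in\mathcal C(Y)[z]$ be obtained by composing the coefficients with $p$; we say that $f$ splits in $Y$ with roots $\alpha_1,\dots,\alpha_n$ if these are $n$ distinct continuous functions $Y\to\mathbb C$ with $(p^*f)_y(\alpha_i(y))=0$ for all $y$. A splitting covering of $f$ is a path-connected covering $q:E_f\to X$ in which $f$ splits, such that for every path-connected covering $p:Y\to X$ in which $f$ splits there is a covering map $\pi:Y\to E_f$ with $q\pi=p$. Let $\beta_1,\dots,\beta_n$ be the roots of $f$ in $E_f$. The semi-topological Galois group of $f$ is $G_f=\mathrm{Aut}_{q^*\mathcal C(X)}\big(q^*\mathcal C(X)[\beta_1,\dots,\beta_n]\big)$, where $q^*\mathcal C(X)=\{\gamma\circ q:\gamma\in\mathcal C(X)\}$, and $A(E_f/X)$ is the group of homeomorphisms $\Phi$ of $E_f$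 with $q\Phi=q$. For functions $\alpha_1,\dots,\alpha_n$ on $Y$ define $\Delta:Y\to\mathbb C$ as follows. For $I=(i_1,\dots,i_{n-1})$ with $0\le i_k\le n-k$ let $\alpha^I=\alpha_1^{i_1}\cdots\alpha_{n-1}^{i_{n-1}}$ and $\sigma^I=\sigma_1^{i_1}\cdots\sigma_{n-1}^{i_{n-1}}\in S_n$, where $\sigma_k$ is the cycle $(k\;k{+}1\;\cdots\;n)$ and permutations are composed from right to left; a permutation $\sigma$ acts on monomials by $\alpha_k\mapsto\alpha_{\sigma(k)}$. Then $\Delta(y)$ is the determinant of the $n!\times n!$ matrix with entries $(\sigma^I(\alpha^J))(y)$, where the rows $I$ and the columns $J$ are listed in the same order. A ring $S$ is called $G$-Galois over a subring $R$ (in the sense of Chase--Harrison--Rosenberg), for a finite subgroup $G\subseteq\mathrm{Aut}_R(S)$, if $S^G=R$ and there are $x_1,\dots,x_m,y_1,\dots,y_m\in S$ with $\sum_i x_i\,\sigma(y_i)=\delta_{e,\sigma}$ for all $\sigma\in G$. **Theorem.** Let $f$ be a Weierstrass polynomial of degree $n$ on $X$. 1. Suppose that $f$ splits in a path-connected covering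 $p:Y\to X$ with roots $\alpha_1,\dots,\alpha_n$, and put $R=p^*\mathcal C(X)$. Then $\Delta$ vanishes nowhere and $\Delta^{-1}\in R[\alpha_1,\dots,\alpha_n]$. 2. In the situation of 1, $R[\alpha_1,\dots,\alpha_n]$ is $G_f$-Galois over $R$. That is, $R[\alpha_1,\dots,\alpha_n]$ is $\mathrm{Aut}_R(R[\alpha_1,\dots,\alpha_n])$-Galois over $R$, and for every splitting covering $q:E_f\to X$ of $f$, with roots $\beta_1,\dots,\beta_n$, there is a ring isomorphism $\Theta:q^*\mathcal C(X)[\beta_1,\dots,\beta_n]\to R[\alpha_1,\dots,\alpha_n]$ with $\Theta(\gamma\circ q)=\gamma\circ p$ for $\gamma\in\mathcal C(X)$ and $\Theta(\beta_i)=\alpha_{\tau(i)}$ for some permutation $\tau$, and $\phi\mapsto\Theta\phi\Theta^{-1}$ is a group isomorphism from $G_f$ onto $\mathrm{Aut}_R(R[\alpha_1,\dots,\alpha_n])$. 3. For every splitting covering $q:E_f\to X$ of $f$, the map $\omega:A(E_f/X)\to G_f$, $\omega(\Phi)(s)=s\circ\Phi^{-1}$, is a well-defined surjective group homomorphism. 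-/

import Mathlib

universe u

namespace SemiTopGalois

open Polynomial

section Weierstrass

variable {X Y : Type*} [TopologicalSpace X] [TopologicalSpace Y]

/-- The pullback `λ^* : C(X) → C(Y)`, `γ ↦ γ ∘ λ`, as a ring homomorphism. -/
noncomputable def pullback (l : C(Y, X)) : C(X, ℂ) →+* C(Y, ℂ) :=
  (ContinuousMap.compRightAlgHom ℂ ℂ l).toRingHom

/-- The induced pullback of polynomials `λ^* : C(X)[z] → C(Y)[z]`. -/
noncomputable def pullbackPoly (l : C(Y, X)) (f : C(X, ℂ)[X]) : C(Y, ℂ)[X] :=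
  f.map (pullback l)

/-- The complex polynomial `f_x`, for `f` in `C(X)[z]` and a point `x`. -/
noncomputable def fiberPoly (f : C(X, ℂ)[X]) (x : X) : ℂ[X] :=
  f.map (ContinuousMap.evalAlgHom ℂ ℂ x).toRingHom

/-- A Weierstrass polynomial of degree `n` on `X`: monic of degree `n`, such that each `f_x` has
`n` distinct roots. -/
structure IsWeierstrass (f : C(X, ℂ)[X]) (n : ℕ) : Prop where
  monic : f.Monic
  natDegree_eq : f.natDegree = n
  ncard_roots : ∀ x : X, {z : ℂ | (fiberPoly f x).eval z = 0}.ncard = n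

/-- A root of `f` on `X`: a continuous function `a` with `f_x(a(x)) = 0` for all `x`. -/
def IsContRoot (f : C(X, ℂ)[X]) (a : C(X, ℂ)) : Prop :=
  ∀ x : X, (fiberPoly f x).eval (a x) = 0

/-- `α_1, …, α_n` are `n` distinct roots of `f` on `X`. -/
def SplitsWithRoots {n : ℕ} (f : C(X, ℂ)[X]) (α : Fin n → C(X, ℂ)) : Prop :=
  Function.Injective α ∧ ∀ i, IsContRoot f (α i)

end Weierstrass

/-- `q : E → X` is a splitting covering of the Weierstrass polynomial `f` of degree `n`: a
path-connected covering space in which `f` splits, and over which every path-connected covering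
space `Y` of `X` in which `f` splits lies, by a covering map compatible with the projections. -/
structure IsSplittingCovering {X E : Type u} [TopologicalSpace X] [TopologicalSpace E]
    (f : C(X, ℂ)[X]) (n : ℕ) (q : C(E, X)) : Prop where
  pathConnected : PathConnectedSpace E
  isCoveringMap : IsCoveringMap q
  splits : ∃ α : Fin n → C(E, ℂ), SplitsWithRoots (pullbackPoly q f) α
  smallest : ∀ (Y : Type u) [TopologicalSpace Y] [PathConnectedSpace Y] (p : C(Y, X)),
    IsCoveringMap p →
    (∃ α : Fin n → C(Y, ℂ), SplitsWithRoots (pullbackPoly p f) α) →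
    ∃ π : C(Y, E), IsCoveringMap π ∧ q.comp π = p

section Rings

variable {X Y : Type*} [TopologicalSpace X] [TopologicalSpace Y]

/-- The subring `p^* C(X)` of `C(Y)`. -/
noncomputable def pullbackRing (p : C(Y, X)) : Subring C(Y, ℂ) :=
  (pullback p).range

/-- The ring `R[α_1, …, α_n]` with `R = p^* C(X)`. -/
noncomputable abbrev rootRing {n : ℕ} (p : C(Y, X)) (α : Fin n → C(Y, ℂ)) :
    Subalgebra (pullbackRing p) C(Y, ℂ) :=
  Algebra.adjoin (pullbackRing p) (Set.range α)

/-- The group `Aut_R(R[α_1, …, α_n])` with `R = p^* C(X)`. When `p` is the splitting covering of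
`f` and the `α_i` are the roots of `f`, this is the semi-topological Galois group `G_f`. -/
abbrev GaloisGroup {n : ℕ} (p : C(Y, X)) (α : Fin n → C(Y, ℂ)) : Type _ :=
  rootRing p α ≃ₐ[pullbackRing p] rootRing p α

/-- The group `A(Y/X)` of covering transformations of `p : Y → X`. -/
def coveringTransformations (p : C(Y, X)) : Subgroup (Y ≃ₜ Y) where
  carrier := {Φ | ∀ y, p (Φ y) = p y}
  one_mem' := fun _ => rfl
  mul_mem' := by
    intro a b ha hb y
    change p (a (b y)) = p y
    rw [ha, hb]
  inv_mem' := by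
    intro a ha y
    have h := ha (a⁻¹ y)
    rw [Homeomorph.inv_apply, Homeomorph.apply_symm_apply] at h
    rw [Homeomorph.inv_apply]
    exact h.symm

end Rings

/-- `S` is `G`-Galois over its subring `R` in the sense of Chase, Harrison and Rosenberg, for a
finite subgroup `G` of `Aut_R(S)`: `S^G = R`, and there are `x_1, …, x_m; y_1, …, y_m` in `S` with
`∑ x_i σ(y_i) = δ_{e,σ}` for all `σ` in `G`. -/
structure IsCHRGalois (R S : Type*) [CommRing R] [CommRing S] [Algebra R S]
    (G : Subgroup (S ≃ₐ[R] S)) : Prop where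
  injective : Function.Injective (algebraMap R S)
  finite : Finite G
  fixed : ∀ s : S, (∀ σ ∈ G, σ s = s) ↔ s ∈ Set.range (algebraMap R S)
  dual : ∃ (m : ℕ) (x y : Fin m → S),
    (∑ i, x i * y i = 1) ∧ ∀ σ ∈ G, σ ≠ 1 → ∑ i, x i * σ (y i) = 0

section Determinant

/-- The multi-indices `I = (i_k)`. The positions `k` are numbered from `0`, so that the bound
`0 ≤ i_k ≤ n - k` for positions numbered from `1` reads `i_k < n - k`. The last position, where
only `i_k = 0` is possible, is included for uniformity and contributes trivial factors. -/
abbrev MultiIndex (n : ℕ) : Type :=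
  (k : Fin n) → Fin (n - k)

/-- The cycle `σ_k = (k k+1 … n)` (here in `0`-based numbering `(k k+1 … n-1)`). -/
def tailCycle (n : ℕ) (k : ℕ) : Equiv.Perm (Fin n) :=
  ((List.finRange n).drop k).formPerm

/-- The permutation `σ^I = σ_1^{i_1} σ_2^{i_2} ⋯`, the product taken in this order. -/
def permOf {n : ℕ} (I : MultiIndex n) : Equiv.Perm (Fin n) :=
  (List.ofFn fun k : Fin n => tailCycle n k ^ (I k : ℕ)).prod

/-- The `n! × n!` matrix `V_n` with entries `φ_I(x_J)`, where `x_J = ∏ α_k^{j_k}` and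
`φ_I = σ^I` acts by `α_k ↦ α_{σ^I(k)}`. Rows and columns are both indexed by the multi-indices;
an enumeration of these, used for rows and columns alike, does not affect the determinant. -/
def vMatrix {S : Type*} [CommRing S] {n : ℕ} (a : Fin n → S) :
    Matrix (MultiIndex n) (MultiIndex n) S :=
  Matrix.of fun I J => ∏ k, a (permOf I k) ^ (J k : ℕ)

/-- The function `Δ(y) = det V(y)` formed from functions `α_1, …, α_n` on `Y`. -/
noncomputable def Delta {Y : Type*} [TopologicalSpace Y] {n : ℕ} (α : Fin n → C(Y, ℂ))
    (y : Y) : ℂ :=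
  (vMatrix fun i => α i y).det

end Determinant

end SemiTopGalois

/-! At each point the values of the `α i` are the `n` distinct roots of one complex polynomial, and
on a connected space a continuous root is determined by a single value. The `σ^I` run exactly once
through `S_n`, so a kernel vector of `V(y)` is a polynomial, of degree at most `n - k` in its `k`-th
variable (counted from 1), vanishing at all orderings of `n` distinct numbers. Such a polynomial is
zero, so `Δ` has no zeros. Relabelling the roots permutes the rows of `V`; hence `Δ²` is constant on
fibres, descends to an invertible function on `X`, and `Δ⁻¹ = Δ · Δ⁻²` (`isUnit_det_vMatrix`).

Two points of a fibre differ by a monodromy permutation of the roots, which path lifting carries to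
every other point. Monodromy permutations act on `R[α]` by automorphisms, and an element fixed by
all of them is constant on fibres, hence in `R`. A column of `V⁻¹` gives the dual elements.
Conversely, every automorphism is a monodromy permutation (`isMonodromy_of_galoisGroup`), by
averaging an element that separates permutations at one point.

Minimality identifies a splitting covering with its image in the space of ordered roots, where
monodromy permutes coordinates; so every automorphism comes from a covering transformation.
Composition with the universal map `Y → E_f` compares the two rings of roots. -/

namespace SemiTopGalois

open Polynomial

/-! ### The products `σ^I` enumerate the symmetric group. -/

section Permutations

theorem tailCycle_pow_apply {n : ℕ} (k : Fin n) (m : ℕ) (hm : m < n - k) :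
    ((tailCycle n k ^ m) k : ℕ) = k + m := by
  have hlen : ((List.finRange n).drop k).length = n - k := by simp
  have h0 : 0 < ((List.finRange n).drop k).length := by rw [hlen]; omega
  have h := List.formPerm_pow_apply_getElem ((List.finRange n).drop k)
    ((List.nodup_finRange n).sublist (List.drop_sublist _ _)) m 0 h0
  have hk : ((List.finRange n).drop k)[0] = k := by simp
  rw [hk] at h
  rw [tailCycle, h]
  simp [Nat.mod_eq_of_lt hm]

theorem tailCycle_apply_of_lt {n k : ℕ} {j : Fin n} (h : (j : ℕ) < k) : tailCycle n k j = j := by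
  refine List.formPerm_apply_of_notMem fun hj => ?_
  obtain ⟨i, hi, rfl⟩ := List.getElem_of_mem hj
  simp at h

theorem prod_tailCycle_drop_apply {n : ℕ} (I : MultiIndex n) (k : ℕ) {j : Fin n}
    (h : (j : ℕ) < k) :
    (((List.ofFn fun k : Fin n => tailCycle n k ^ (I k : ℕ)).drop k).prod) j = j := by
  suffices H : ∀ l : List (Equiv.Perm (Fin n)), (∀ σ ∈ l, σ j = j) → l.prod j = j by
    refine H _ fun σ hσ => ?_
    obtain ⟨i, hi, rfl⟩ := List.getElem_of_mem hσ
    simp only [List.getElem_drop, List.getElem_ofFn]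
    exact Function.IsFixedPt.perm_pow (tailCycle_apply_of_lt
      (show (j : ℕ) < k + i by omega)) _
  intro l
  induction l with
  | nil => simp
  | cons σ l ih =>
    intro hl
    rw [List.prod_cons, Equiv.Perm.mul_apply, ih fun τ hτ => hl τ (List.mem_cons_of_mem _ hτ)]
    exact hl σ List.mem_cons_self

theorem prod_tailCycle_drop {n : ℕ} (I : MultiIndex n) (k : Fin n) :
    ((List.ofFn fun k : Fin n => tailCycle n k ^ (I k : ℕ)).drop k).prod =
      tailCycle n k ^ (I k : ℕ) *
        ((List.ofFn fun k : Fin n => tailCycle n k ^ (I k : ℕ)).drop (k + 1)).prod := by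
  rw [List.drop_eq_getElem_cons (by simp), List.prod_cons, List.getElem_ofFn]

/-- The factors after the `k`-th fix position `k`, so the product of the factors from `k` on sends
`k` to `k + I k`. This reads off `I k`; cancelling that factor exposes the next index. -/
theorem permOf_injective (n : ℕ) : Function.Injective (permOf (n := n)) := by
  intro I J hIJ
  have key : ∀ k : ℕ, (∀ j : Fin n, (j : ℕ) < k → I j = J j) ∧
      ((List.ofFn fun k : Fin n => tailCycle n k ^ (I k : ℕ)).drop k).prod =
        ((List.ofFn fun k : Fin n => tailCycle n k ^ (J k : ℕ)).drop k).prod := by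
    intro k
    induction k with
    | zero => exact ⟨fun j hj => absurd hj (Nat.not_lt_zero _), by simpa [permOf] using hIJ⟩
    | succ k ih =>
      obtain ⟨ih1, ih2⟩ := ih
      by_cases hk : k < n
      · have ih2 := ((prod_tailCycle_drop I ⟨k, hk⟩).symm.trans ih2).trans
          (prod_tailCycle_drop J ⟨k, hk⟩)
        have hval : (I ⟨k, hk⟩ : ℕ) = J ⟨k, hk⟩ := by
          have h := congrArg (fun σ : Equiv.Perm (Fin n) => ((σ ⟨k, hk⟩ : Fin n) : ℕ)) ih2
          simp only [Equiv.Perm.mul_apply] at h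
          rw [prod_tailCycle_drop_apply I (k + 1) (j := ⟨k, hk⟩) (Nat.lt_succ_self k),
            prod_tailCycle_drop_apply J (k + 1) (j := ⟨k, hk⟩) (Nat.lt_succ_self k)] at h
          have h1 := tailCycle_pow_apply ⟨k, hk⟩ (I ⟨k, hk⟩) (I ⟨k, hk⟩).2
          have h2 := tailCycle_pow_apply ⟨k, hk⟩ (J ⟨k, hk⟩) (J ⟨k, hk⟩).2
          simp only at h1 h2
          omega
        refine ⟨fun j hj => ?_, ?_⟩
        · rcases Nat.lt_succ_iff_lt_or_eq.mp hj with hj | hj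
          · exact ih1 j hj
          · obtain rfl : j = ⟨k, hk⟩ := Fin.ext hj
            exact Fin.ext hval
        · rw [hval] at ih2
          exact mul_left_cancel ih2
      · refine ⟨fun j hj => ih1 j (by omega), ?_⟩
        rw [List.drop_of_length_le (by simp; omega), List.drop_of_length_le (by simp; omega)]
  funext j
  exact (key n).1 j j.2

theorem card_multiIndex (n : ℕ) : Fintype.card (MultiIndex n) = n.factorial := by
  rw [Fintype.card_pi]
  simp only [Fintype.card_fin]
  rw [Fin.prod_univ_eq_prod_range (fun k => n - k) n, ← Nat.descFactorial_eq_prod_range, Nat.descFactorial_self]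

theorem permOf_bijective (n : ℕ) : Function.Bijective (permOf (n := n)) := by
  rw [Fintype.bijective_iff_injective_and_card]
  exact ⟨permOf_injective n, by rw [card_multiIndex, Fintype.card_perm, Fintype.card_fin]⟩

end Permutations

/-! ### Nonvanishing and symmetry of the determinant. -/

section Determinants

/-- A polynomial of degree less than `#A - k` in its `k`-th variable that vanishes at all tuples of
distinct elements of `A` is zero. -/
theorem coeff_eq_zero_of_vanishing {K : Type*} [Field K] [DecidableEq K] {n : ℕ} (d : Fin n → ℕ)
    (A : Finset K) (hd : ∀ k, d k ≤ A.card - k) (hA : n ≤ A.card) (c : ((k : Fin n) → Fin (d k)) → K)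
    (h : ∀ b : Fin n → K, Function.Injective b → (∀ k, b k ∈ A) →
      ∑ J, c J * ∏ k, b k ^ (J k : ℕ) = 0) : c = 0 := by
  induction n generalizing A with
  | zero =>
    funext J
    have h0 := h Fin.elim0 (fun i => i.elim0) (fun i => i.elim0)
    rw [Fintype.sum_eq_single J fun J' hJ => (hJ (Subsingleton.elim _ _)).elim] at h0
    simpa using h0
  | succ n ih =>
    let e := Fin.consEquiv fun k : Fin (n + 1) => Fin (d k)
    -- Fixing the first variable at `t` leaves distinct tuples from `A.erase t`. The set loses one
    -- element while the variables shift by one, so the degree bounds persist.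
    have step : ∀ t ∈ A, ∀ J' : (k : Fin n) → Fin (d k.succ),
        ∑ j : Fin (d 0), c (Fin.cons j J') * t ^ (j : ℕ) = 0 := by
      intro t ht J'
      have hcard : (A.erase t).card = A.card - 1 := Finset.card_erase_of_mem ht
      refine congrFun (ih (fun k => d k.succ) (A.erase t) (fun k => ?_) (by omega)
        (fun J' => ∑ j : Fin (d 0), c (Fin.cons j J') * t ^ (j : ℕ)) fun b hb hbA => ?_) J'
      · have := hd k.succ
        rw [Fin.val_succ] at this
        omega
      · have hinj : Function.Injective (Fin.cons t b : Fin (n + 1) → K) := by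
          rw [Fin.cons_injective_iff]
          refine ⟨?_, hb⟩
          rintro ⟨k, hk⟩
          exact (Finset.mem_erase.mp (hbA k)).1 hk
        have := h (Fin.cons t b) hinj fun k => by
          refine Fin.cases ht (fun k => ?_) k
          exact Finset.mem_of_mem_erase (hbA k)
        rw [← e.sum_comp, Fintype.sum_prod_type, Finset.sum_comm] at this
        rw [← this]
        refine Finset.sum_congr rfl fun J' _ => ?_
        rw [Finset.sum_mul]
        refine Finset.sum_congr rfl fun j _ => ?_
        rw [Fin.prod_univ_succ]
        simp [e, Fin.consEquiv, mul_assoc]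
    funext J
    obtain ⟨⟨j, J'⟩, rfl⟩ := e.surjective J
    -- Each coefficient in the remaining variables is a polynomial in `t` of degree below `A.card`
    -- that vanishes on `A`.
    let P : K[X] := ∑ j : Fin (d 0), C (c (Fin.cons j J')) * X ^ (j : ℕ)
    have hdeg : P.degree < A.card := by
      refine (degree_sum_fin_lt fun j => c (Fin.cons j J')).trans_le ?_
      exact_mod_cast hd 0
    have hP : P = 0 := by
      refine eq_zero_of_degree_lt_of_eval_finset_eq_zero A hdeg fun t ht => ?_
      simpa [P, eval_finsetSum] using step t ht J'
    have hc : P.coeff j = c (Fin.cons j J') := by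
      simp only [P, finsetSum_coeff, coeff_C_mul, coeff_X_pow]
      rw [Finset.sum_eq_single j]
      · simp
      · intro i _ hi
        rw [if_neg fun h => hi (Fin.ext h.symm), mul_zero]
      · simp
    rw [hP, coeff_zero] at hc
    exact hc.symm

/-- A kernel vector is the coefficient family of a polynomial vanishing at every ordering of the `a
i`, because the rows exhaust `S_n`. -/
theorem det_vMatrix_ne_zero {K : Type*} [Field K] {n : ℕ} {a : Fin n → K}
    (ha : Function.Injective a) : (vMatrix a).det ≠ 0 := by
  classical
  intro h
  obtain ⟨c, hc, hV⟩ := Matrix.exists_mulVec_eq_zero_iff.mpr h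
  refine hc (coeff_eq_zero_of_vanishing (fun k : Fin n => n - k) (Finset.univ.image a) ?_ ?_ c ?_)
  · intro k
    rw [Finset.card_image_of_injective _ ha, Finset.card_univ, Fintype.card_fin]
  · rw [Finset.card_image_of_injective _ ha, Finset.card_univ, Fintype.card_fin]
  · intro b hb hbA
    have : ∀ k, ∃ i, a i = b k := fun k => by simpa using hbA k
    choose s hs using this
    have hsinj : Function.Injective s := fun i j hij => hb (by rw [← hs, ← hs, hij])
    obtain ⟨I, hI⟩ := (permOf_bijective n).2
      (Equiv.ofBijective s (Finite.injective_iff_bijective.mp hsinj))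
    have := congrFun hV I
    rw [Matrix.mulVec, dotProduct, Pi.zero_apply] at this
    rw [← this]
    refine Finset.sum_congr rfl fun J _ => ?_
    rw [mul_comm]
    simp [vMatrix, hI, hs]

theorem map_det_vMatrix {S T : Type*} [CommRing S] [CommRing T] (φ : S →+* T) {n : ℕ}
    (a : Fin n → S) : φ (vMatrix a).det = (vMatrix fun i => φ (a i)).det := by
  rw [RingHom.map_det]
  congr 1
  ext I J
  simp [vMatrix]

/-- Left multiplication by `σ` permutes the rows; squaring removes the sign. -/
theorem det_vMatrix_comp_perm_sq {S : Type*} [CommRing S] {n : ℕ} (a : Fin n → S)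
    (σ : Equiv.Perm (Fin n)) : (vMatrix fun i => a (σ i)).det ^ 2 = (vMatrix a).det ^ 2 := by
  let e := Equiv.ofBijective _ (permOf_bijective n)
  let ρ : Equiv.Perm (MultiIndex n) := (e.trans (Equiv.mulLeft σ)).trans e.symm
  have h : (vMatrix fun i => a (σ i)) = (vMatrix a).submatrix ρ id := by
    ext I J
    have : permOf (ρ I) = σ * permOf I := e.apply_symm_apply _
    simp [vMatrix, this]
  rw [h, Matrix.det_permute, mul_pow]
  rcases Int.units_eq_one_or (Equiv.Perm.sign ρ) with h | h <;> simp [h]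

end Determinants

/-! ### Continuous roots of Weierstrass polynomials. -/

section ContinuousRoots

variable {X Y : Type*} [TopologicalSpace X] [TopologicalSpace Y]

theorem fiberPoly_pullbackPoly (p : C(Y, X)) (f : C(X, ℂ)[X]) (y : Y) :
    fiberPoly (pullbackPoly p f) y = fiberPoly f (p y) := by
  rw [fiberPoly, fiberPoly, pullbackPoly, Polynomial.map_map]
  rfl

theorem eval_fiberPoly (f : C(X, ℂ)[X]) (a : C(X, ℂ)) (x : X) :
    (fiberPoly f x).eval (a x) = f.eval a x :=
  Polynomial.eval_map_apply (ContinuousMap.evalAlgHom ℂ ℂ x).toRingHom a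

theorem isContRoot_iff {f : C(X, ℂ)[X]} {a : C(X, ℂ)} : IsContRoot f a ↔ f.eval a = 0 := by
  simp only [IsContRoot, eval_fiberPoly, ContinuousMap.ext_iff, ContinuousMap.zero_apply]

theorem isContRoot_pullbackPoly {p : C(Y, X)} {f : C(X, ℂ)[X]} {a : C(Y, ℂ)} :
    IsContRoot (pullbackPoly p f) a ↔ ∀ y, (fiberPoly f (p y)).eval (a y) = 0 := by
  simp only [IsContRoot, fiberPoly_pullbackPoly]

theorem SplitsWithRoots.comp_of_surjective {E : Type*} [TopologicalSpace E] {n : ℕ}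
    {f : C(X, ℂ)[X]} {q : C(E, X)} {β : Fin n → C(E, ℂ)}
    (hβ : SplitsWithRoots (pullbackPoly q f) β) {π : C(Y, E)} (hπ : Function.Surjective π)
    {p : C(Y, X)} (hp : q.comp π = p) :
    SplitsWithRoots (pullbackPoly p f) fun i => (β i).comp π := by
  refine ⟨fun i j h => hβ.1 (ContinuousMap.ext fun e => ?_), fun i => ?_⟩
  · obtain ⟨y, rfl⟩ := hπ e
    exact ContinuousMap.congr_fun h y
  · rw [isContRoot_pullbackPoly, ← hp]
    exact fun y => isContRoot_pullbackPoly.mp (hβ.2 i) (π y)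

theorem IsWeierstrass.pullbackPoly [Nonempty Y] {f : C(X, ℂ)[X]} {n : ℕ} (hf : IsWeierstrass f n)
    (p : C(Y, X)) : IsWeierstrass (pullbackPoly p f) n where
  monic := hf.monic.map _
  natDegree_eq := (hf.monic.natDegree_map _).trans hf.natDegree_eq
  ncard_roots y := by simpa only [fiberPoly_pullbackPoly] using hf.ncard_roots (p y)

theorem IsWeierstrass.finite_roots {f : C(X, ℂ)[X]} {n : ℕ} (hf : IsWeierstrass f n) (x : X) :
    {z : ℂ | (fiberPoly f x).eval z = 0}.Finite := by
  have h0 : fiberPoly f x ≠ 0 := (hf.monic.map _).ne_zero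
  refine (fiberPoly f x).roots.toFinset.finite_toSet.subset fun z hz => ?_
  simpa [h0] using hz

theorem IsWeierstrass.eval_derivative_ne_zero {f : C(X, ℂ)[X]} {n : ℕ} (hf : IsWeierstrass f n)
    {x : X} {z : ℂ} (hz : (fiberPoly f x).eval z = 0) :
    (derivative (fiberPoly f x)).eval z ≠ 0 := by
  have : Nonempty X := ⟨x⟩
  have hm : (fiberPoly f x).Monic := hf.monic.map _
  have hdeg : (fiberPoly f x).natDegree = n := (hf.monic.natDegree_map _).trans hf.natDegree_eq
  have hset : {z : ℂ | (fiberPoly f x).eval z = 0} = (fiberPoly f x).roots.toFinset := by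
    ext w
    simp [hm.ne_zero]
  have hcard : (fiberPoly f x).roots.toFinset.card = (fiberPoly f x).roots.card := by
    rw [← Set.ncard_coe_finset, ← hset, hf.ncard_roots,
      (IsAlgClosed.splits (fiberPoly f x)).natDegree_eq_card_roots.symm, hdeg]
  have hnodup := Multiset.toFinset_card_eq_card_iff_nodup.mp hcard
  intro h
  have h1 := (one_lt_rootMultiplicity_iff_isRoot hm.ne_zero).mpr ⟨hz, h⟩
  rw [← count_roots] at h1
  exact absurd (Multiset.nodup_iff_count_le_one.mp hnodup z) (not_le.mpr h1)

/-- Two continuous roots of a Weierstrass polynomial that agree at a point of a connected space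
are equal. -/
theorem IsWeierstrass.root_eq_of_apply_eq [PreconnectedSpace X] {f : C(X, ℂ)[X]} {n : ℕ}
    (hf : IsWeierstrass f n) {a b : C(X, ℂ)} (ha : IsContRoot f a) (hb : IsContRoot f b) {x₀ : X}
    (h : a x₀ = b x₀) : a = b := by
  -- Taylor expansion at `b` gives `(a - b)(f'(b) + k(a - b)) = 0`. Where `a = b` the second factor
  -- is `f'(b) ≠ 0`, so the set of agreement is where that factor does not vanish, which is open.
  obtain ⟨k, hk⟩ := f.binomExpansion b (a - b)
  have hmul : (a - b) * (f.derivative.eval b + k * (a - b)) = 0 := by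
    rw [add_sub_cancel, isContRoot_iff.mp ha, isContRoot_iff.mp hb] at hk
    linear_combination -hk
  have hb' (x : X) : f.derivative.eval b x ≠ 0 := by
    rw [← eval_fiberPoly, fiberPoly, ← derivative_map]
    exact hf.eval_derivative_ne_zero (hb x)
  have hset : {x | a x = b x} = {x | (f.derivative.eval b + k * (a - b)) x ≠ 0} := by
    ext x
    have hx := ContinuousMap.congr_fun hmul x
    simp only [ContinuousMap.mul_apply, ContinuousMap.sub_apply, ContinuousMap.zero_apply,
      mul_eq_zero, sub_eq_zero] at hx
    refine ⟨fun h => ?_, fun h => hx.resolve_right h⟩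
    have h' : a x = b x := h
    simpa [h'] using hb' x
  have hclopen : IsClopen {x | a x = b x} :=
    ⟨isClosed_eq a.continuous b.continuous, by
      rw [hset]
      exact isOpen_ne_fun (map_continuous _) continuous_const⟩
  ext x
  exact (hclopen.eq_univ ⟨x₀, h⟩).ge (Set.mem_univ x)

variable {n : ℕ} {f : C(X, ℂ)[X]} {α : Fin n → C(X, ℂ)}

theorem SplitsWithRoots.apply_injective [PreconnectedSpace X] (hα : SplitsWithRoots f α)
    (hf : IsWeierstrass f n) (x : X) : Function.Injective fun i => α i x :=
  fun i j h => hα.1 (hf.root_eq_of_apply_eq (hα.2 i) (hα.2 j) h)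

theorem SplitsWithRoots.exists_apply_eq [PreconnectedSpace X] (hα : SplitsWithRoots f α)
    (hf : IsWeierstrass f n) {x : X} {z : ℂ} (hz : (fiberPoly f x).eval z = 0) :
    ∃ i, α i x = z := by
  have hsub : Set.range (fun i => α i x) ⊆ {z : ℂ | (fiberPoly f x).eval z = 0} := by
    rintro _ ⟨i, rfl⟩
    exact hα.2 i x
  have heq := Set.eq_of_subset_of_ncard_le hsub (by
    rw [hf.ncard_roots, ← Set.image_univ,
      Set.ncard_image_of_injective _ (hα.apply_injective hf x), Set.ncard_univ]
    simp) (hf.finite_roots x)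
  exact heq.ge hz

theorem SplitsWithRoots.exists_eq [ConnectedSpace X] (hα : SplitsWithRoots f α)
    (hf : IsWeierstrass f n) {a : C(X, ℂ)} (ha : IsContRoot f a) : ∃ i, α i = a := by
  obtain ⟨x⟩ := (inferInstance : Nonempty X)
  obtain ⟨i, hi⟩ := hα.exists_apply_eq hf (ha x)
  exact ⟨i, hf.root_eq_of_apply_eq (hα.2 i) ha hi⟩

theorem SplitsWithRoots.exists_perm [ConnectedSpace X] (hα : SplitsWithRoots f α)
    (hf : IsWeierstrass f n) {a : Fin n → C(X, ℂ)} (ha : SplitsWithRoots f a) :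
    ∃ τ : Equiv.Perm (Fin n), ∀ i, a i = α (τ i) := by
  choose t ht using fun i => hα.exists_eq hf (ha.2 i)
  have hinj : Function.Injective t := fun i j h => ha.1 (by rw [← ht, ← ht, h])
  exact ⟨Equiv.ofBijective t (Finite.injective_iff_bijective.mp hinj), fun i => (ht i).symm⟩

end ContinuousRoots

/-! ### Path lifting and descent to the base. -/

section Coverings

variable {X Y : Type*} [TopologicalSpace X] [TopologicalSpace Y]

/-- A path lifts along a covering map, starting at any point over its initial point. -/
theorem exists_lift_of_joined {p : C(Y, X)} (hp : IsCoveringMap p) (γ : C(unitInterval, X)) {y : Y}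
    (hy : p y = γ 0) : ∃ Γ : C(unitInterval, Y), (∀ t, p (Γ t) = γ t) ∧ Γ 0 = y :=
  ⟨hp.liftPath γ y hy.symm, congrFun (hp.liftPath_lifts γ y hy.symm), hp.liftPath_zero γ y hy.symm⟩

/-- `IsCoveringMap` allows empty fibres; path-connectedness of the base rules them out. -/
theorem surjective_of_isCoveringMap [Nonempty Y] [PathConnectedSpace X] {p : C(Y, X)}
    (hp : IsCoveringMap p) : Function.Surjective p := by
  intro x
  obtain ⟨y⟩ := (inferInstance : Nonempty Y)
  obtain ⟨γ⟩ := PathConnectedSpace.joined (p y) x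
  obtain ⟨Γ, hΓ, -⟩ := exists_lift_of_joined hp γ.toContinuousMap γ.source.symm
  exact ⟨Γ 1, (hΓ 1).trans γ.target⟩

theorem mem_pullbackRing_of_constant_on_fibers [Nonempty Y] [PathConnectedSpace X] {p : C(Y, X)}
    (hp : IsCoveringMap p) (g : C(Y, ℂ)) (hg : ∀ y y', p y = p y' → g y = g y') :
    ∃ γ : C(X, ℂ), pullback p γ = g := by
  have hq : Topology.IsQuotientMap p := hp.isQuotientMap (surjective_of_isCoveringMap hp)
  exact ⟨hq.lift g hg, by ext y; exact ContinuousMap.congr_fun (hq.lift_comp g hg) y⟩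

end Coverings

/-! ### Monodromy permutations. -/

section Monodromy

variable {X Y : Type*} [TopologicalSpace X] [TopologicalSpace Y] {n : ℕ}

/-- The monodromy permutations of the roots `α_1, …, α_n`: over the image of every point `y` there
is a point in which the roots take the values at `y`, permuted. -/
def IsMonodromy (p : C(Y, X)) (α : Fin n → C(Y, ℂ)) (σ : Equiv.Perm (Fin n)) : Prop :=
  ∀ y, ∃ y', p y' = p y ∧ ∀ i, α i y' = α (σ i) y

theorem isMonodromy_one (p : C(Y, X)) (α : Fin n → C(Y, ℂ)) : IsMonodromy p α 1 :=
  fun y => ⟨y, rfl, fun _ => rfl⟩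

theorem IsMonodromy.mul {p : C(Y, X)} {α : Fin n → C(Y, ℂ)} {σ τ : Equiv.Perm (Fin n)}
    (hσ : IsMonodromy p α σ) (hτ : IsMonodromy p α τ) : IsMonodromy p α (σ * τ) := by
  intro y
  obtain ⟨y', h1, h2⟩ := hσ y
  obtain ⟨y'', h3, h4⟩ := hτ y'
  exact ⟨y'', h3.trans h1, fun i => by rw [h4, h2, Equiv.Perm.mul_apply]⟩

theorem IsMonodromy.pow {p : C(Y, X)} {α : Fin n → C(Y, ℂ)} {σ : Equiv.Perm (Fin n)}
    (hσ : IsMonodromy p α σ) (m : ℕ) : IsMonodromy p α (σ ^ m) := by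
  induction m with
  | zero => exact isMonodromy_one p α
  | succ m ih => rw [pow_succ]; exact ih.mul hσ

/-- The definition only moves from `y` to some `y'`, but in a finite group the inverse is a power.
-/
theorem IsMonodromy.inv {p : C(Y, X)} {α : Fin n → C(Y, ℂ)} {σ : Equiv.Perm (Fin n)}
    (hσ : IsMonodromy p α σ) : IsMonodromy p α σ⁻¹ := by
  rw [inv_eq_of_mul_eq_one_right (b := σ ^ (orderOf σ - 1)) (by
    rw [← pow_succ', Nat.sub_add_cancel (orderOf_pos σ), pow_orderOf_eq_one])]
  exact hσ.pow _

variable [PathConnectedSpace Y] {p : C(Y, X)} {f : C(X, ℂ)[X]} {α : Fin n → C(Y, ℂ)}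

/-- Project a path from `y` to `y₁` and lift it from `y'`. The roots along both paths are continuous
roots of one polynomial on the unit interval, matched by `σ` at time `0` and hence at time `1`. -/
theorem isMonodromy_of_apply_eq (hf : IsWeierstrass f n) (hp : IsCoveringMap p)
    (hα : SplitsWithRoots (pullbackPoly p f) α) {y y' : Y} (hy : p y' = p y)
    {σ : Equiv.Perm (Fin n)} (hσ : ∀ i, α i y' = α (σ i) y) : IsMonodromy p α σ := by
  intro y₁
  obtain ⟨γ⟩ := PathConnectedSpace.joined y y₁
  obtain ⟨Γ, hΓ, hΓ0⟩ := exists_lift_of_joined hp (p.comp γ.toContinuousMap) (y := y')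
    (by rw [hy]; exact congrArg p γ.source.symm)
  have hr (i j : Fin n) (h : α i y' = α j y) :
      (α i).comp Γ = (α j).comp γ.toContinuousMap := by
    have hg := hf.pullbackPoly (p.comp γ.toContinuousMap)
    refine hg.root_eq_of_apply_eq (x₀ := 0) ?_ ?_ ?_
    · rw [isContRoot_pullbackPoly]
      intro t
      rw [← hΓ t]
      exact isContRoot_pullbackPoly.mp (hα.2 i) (Γ t)
    · rw [isContRoot_pullbackPoly]
      exact fun t => isContRoot_pullbackPoly.mp (hα.2 j) (γ t)
    · rw [ContinuousMap.comp_apply, ContinuousMap.comp_apply, hΓ0, h]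
      exact congrArg (α j) γ.source.symm
  refine ⟨Γ 1, (hΓ 1).trans (congrArg p γ.target), fun i => ?_⟩
  exact (ContinuousMap.congr_fun (hr i (σ i) (hσ i)) 1).trans (congrArg (α (σ i)) γ.target)

theorem exists_isMonodromy (hf : IsWeierstrass f n) (hp : IsCoveringMap p)
    (hα : SplitsWithRoots (pullbackPoly p f) α) {y y' : Y} (hy : p y' = p y) :
    ∃ σ : Equiv.Perm (Fin n), IsMonodromy p α σ ∧ ∀ i, α i y' = α (σ i) y := by
  have hw := hf.pullbackPoly p
  have hex (i : Fin n) : ∃ j, α j y = α i y' := by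
    refine hα.exists_apply_eq hw ?_
    rw [fiberPoly_pullbackPoly, ← hy]
    exact isContRoot_pullbackPoly.mp (hα.2 i) y'
  choose s hs using hex
  have hinj : Function.Injective s := fun i j h =>
    hα.apply_injective hw y' (by simp only [← hs, h])
  let σ := Equiv.ofBijective s (Finite.injective_iff_bijective.mp hinj)
  exact ⟨σ, isMonodromy_of_apply_eq hf hp hα hy fun i => (hs i).symm, fun i => (hs i).symm⟩

end Monodromy

/-! ### The ring of roots, its automorphisms and the Galois property. -/

section RootRing

variable {X Y : Type*} [TopologicalSpace X] [TopologicalSpace Y] {n : ℕ}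

/-- The root `α_i` as an element of `R[α_1, …, α_n]`. -/
noncomputable def rootRingGen (p : C(Y, X)) (α : Fin n → C(Y, ℂ)) (i : Fin n) : rootRing p α :=
  ⟨α i, Algebra.subset_adjoin ⟨i, rfl⟩⟩

/-- Evaluation at a point, on `R[α_1, …, α_n]`. -/
noncomputable def rootRingEval (p : C(Y, X)) (α : Fin n → C(Y, ℂ)) (y : Y) : rootRing p α →+* ℂ :=
  (ContinuousMap.evalAlgHom ℂ ℂ y).toRingHom.comp (rootRing p α).val.toRingHom

/-- The pullback `γ ↦ γ ∘ p`, with values in `R = p^* C(X)`. -/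
noncomputable def toPullbackRing (p : C(Y, X)) : C(X, ℂ) →+* pullbackRing p :=
  (pullback p).rangeRestrict

/-- The element `γ ∘ p` of `R[α_1, …, α_n]`. -/
noncomputable def rootRingPullback (p : C(Y, X)) (α : Fin n → C(Y, ℂ)) (γ : C(X, ℂ)) :
    rootRing p α :=
  algebraMap (pullbackRing p) _ (toPullbackRing p γ)

variable {p : C(Y, X)} {α : Fin n → C(Y, ℂ)}

theorem rootRingEval_apply (s : rootRing p α) (y : Y) :
    rootRingEval p α y s = (s : C(Y, ℂ)) y := rfl

theorem rootRing_ext {s t : rootRing p α} (h : ∀ y, (s : C(Y, ℂ)) y = (t : C(Y, ℂ)) y) : s = t :=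
  Subtype.ext (ContinuousMap.ext h)

theorem rootRing_algHom_ext {A : Type*} [Semiring A] [Algebra (pullbackRing p) A]
    {φ ψ : rootRing p α →ₐ[pullbackRing p] A}
    (h : ∀ i, φ (rootRingGen p α i) = ψ (rootRingGen p α i)) : φ = ψ := by
  refine AlgHom.adjoin_ext ?_
  rintro _ ⟨i, rfl⟩
  exact h i

theorem mem_range_algebraMap_iff {s : rootRing p α} :
    s ∈ Set.range (algebraMap (pullbackRing p) (rootRing p α)) ↔
      ∃ γ : C(X, ℂ), pullback p γ = s := by
  constructor
  · rintro ⟨⟨r, γ, hγ⟩, rfl⟩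
    exact ⟨γ, hγ⟩
  · rintro ⟨γ, hγ⟩
    exact ⟨⟨s, γ, hγ⟩, rfl⟩

/-- Substitute `α (σ i)` for `α i` in an expression for `s`. The result may depend on the
expression; only for monodromy permutations are its values forced. -/
theorem exists_rootRing_perm {σ : Equiv.Perm (Fin n)} (s : rootRing p α) :
    ∃ t : rootRing p α, ∀ y y', p y' = p y → (∀ i, α i y' = α (σ i) y) →
      (t : C(Y, ℂ)) y = (s : C(Y, ℂ)) y' := by
  obtain ⟨s, hs⟩ := s
  induction hs using Algebra.adjoin_induction with
  | mem _ h =>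
    obtain ⟨i, rfl⟩ := h
    exact ⟨rootRingGen p α (σ i), fun y y' _ h => (h i).symm⟩
  | algebraMap r =>
    refine ⟨algebraMap _ _ r, fun y y' h _ => ?_⟩
    obtain ⟨_, γ, rfl⟩ := r
    exact congrArg γ h.symm
  | add _ _ _ _ h₁ h₂ =>
    obtain ⟨t₁, h₁⟩ := h₁
    obtain ⟨t₂, h₂⟩ := h₂
    exact ⟨t₁ + t₂, fun y y' h h' => congrArg₂ (· + ·) (h₁ y y' h h') (h₂ y y' h h')⟩
  | mul _ _ _ _ h₁ h₂ =>
    obtain ⟨t₁, h₁⟩ := h₁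
    obtain ⟨t₂, h₂⟩ := h₂
    exact ⟨t₁ * t₂, fun y y' h h' => congrArg₂ (· * ·) (h₁ y y' h h') (h₂ y y' h h')⟩

theorem IsMonodromy.exists_algHom {σ : Equiv.Perm (Fin n)} (hσ : IsMonodromy p α σ) :
    ∃ φ : rootRing p α →ₐ[pullbackRing p] rootRing p α, ∀ s y y', p y' = p y →
      (∀ i, α i y' = α (σ i) y) → (φ s : C(Y, ℂ)) y = (s : C(Y, ℂ)) y' := by
  choose φ hφ using exists_rootRing_perm (p := p) (α := α) (σ := σ)
  choose y' hy' hα using hσ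
  have key (s : rootRing p α) (y : Y) : (φ s : C(Y, ℂ)) y = (s : C(Y, ℂ)) (y' y) :=
    hφ s y (y' y) (hy' y) (hα y)
  refine ⟨{ toFun := φ
            map_one' := rootRing_ext fun y => key 1 y
            map_mul' := fun s t => rootRing_ext fun y => ?_
            map_zero' := rootRing_ext fun y => key 0 y
            map_add' := fun s t => rootRing_ext fun y => ?_
            commutes' := fun r => rootRing_ext fun y => ?_ }, hφ⟩
  · exact (key _ y).trans (congrArg₂ (· * ·) (key s y) (key t y)).symm
  · exact (key _ y).trans (congrArg₂ (· + ·) (key s y) (key t y)).symm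
  · rw [key]
    obtain ⟨_, γ, rfl⟩ := r
    exact congrArg γ (hy' y)

/-- A monodromy permutation acts on `R[α_1, …, α_n]` by an automorphism over `R`. -/
theorem IsMonodromy.exists_galoisGroup {σ : Equiv.Perm (Fin n)} (hσ : IsMonodromy p α σ) :
    ∃ φ : GaloisGroup p α, ∀ s y y', p y' = p y →
      (∀ i, α i y' = α (σ i) y) → (φ s : C(Y, ℂ)) y = (s : C(Y, ℂ)) y' := by
  -- If `y'` realises `τ` from `y`, then `y` realises `ρ = τ⁻¹` from `y'`.
  have comp_eq {τ ρ : Equiv.Perm (Fin n)} (hτ : IsMonodromy p α τ) (hτρ : τ * ρ = 1)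
      {φ ψ : rootRing p α →ₐ[pullbackRing p] rootRing p α}
      (hφ : ∀ s y y', p y' = p y → (∀ i, α i y' = α (τ i) y) →
        (φ s : C(Y, ℂ)) y = (s : C(Y, ℂ)) y')
      (hψ : ∀ s y y', p y' = p y → (∀ i, α i y' = α (ρ i) y) →
        (ψ s : C(Y, ℂ)) y = (s : C(Y, ℂ)) y') : φ.comp ψ = AlgHom.id _ _ := by
    refine AlgHom.ext fun s => rootRing_ext fun y => ?_
    obtain ⟨y', h1, h2⟩ := hτ y
    rw [AlgHom.comp_apply, hφ _ y y' h1 h2, AlgHom.id_apply]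
    refine hψ s y' y h1.symm fun i => ?_
    rw [h2, ← Equiv.Perm.mul_apply, hτρ, Equiv.Perm.one_apply]
  obtain ⟨φ, hφ⟩ := hσ.exists_algHom
  obtain ⟨ψ, hψ⟩ := hσ.inv.exists_algHom
  exact ⟨AlgEquiv.ofAlgHom φ ψ (comp_eq hσ (mul_inv_cancel σ) hφ hψ)
    (comp_eq hσ.inv (inv_mul_cancel σ) hψ hφ), hφ⟩

theorem rootRingEval_det_vMatrix (y : Y) :
    rootRingEval p α y (vMatrix (rootRingGen p α)).det = Delta α y :=
  map_det_vMatrix (rootRingEval p α y) (rootRingGen p α)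

variable {f : C(X, ℂ)[X]}

/-- Being a root is an algebraic equation over `R`, hence preserved by automorphisms. -/
theorem isContRoot_coe_iff {s : rootRing p α} : IsContRoot (pullbackPoly p f) (s : C(Y, ℂ)) ↔
    aeval s (f.map (toPullbackRing p)) = 0 := by
  have h := aeval_algHom_apply (rootRing p α).val s (f.map (toPullbackRing p))
  rw [aeval_def, eval₂_map] at h
  rw [isContRoot_iff, pullbackPoly, eval_map, ← Subtype.coe_inj]
  exact Eq.congr_left h

variable [PathConnectedSpace Y]

theorem exists_perm_of_galoisGroup (hf : IsWeierstrass f n)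
    (hα : SplitsWithRoots (pullbackPoly p f) α) (φ : GaloisGroup p α) :
    ∃ τ : Equiv.Perm (Fin n), ∀ i, φ (rootRingGen p α i) = rootRingGen p α (τ i) := by
  have hsplit : SplitsWithRoots (pullbackPoly p f)
      fun i => (φ (rootRingGen p α i) : C(Y, ℂ)) := by
    refine ⟨fun i j h => hα.1 ?_, fun i => ?_⟩
    · exact congrArg Subtype.val (φ.injective (Subtype.ext h))
    · have h := aeval_algHom_apply φ.toAlgHom (rootRingGen p α i) (f.map (toPullbackRing p))
      rw [isContRoot_coe_iff (s := rootRingGen p α i) |>.mp (hα.2 i), map_zero] at h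
      exact isContRoot_coe_iff.mpr h
  obtain ⟨τ, hτ⟩ := hα.exists_perm (hf.pullbackPoly p) hsplit
  exact ⟨τ, fun i => Subtype.ext (hτ i)⟩

theorem finite_galoisGroup (hf : IsWeierstrass f n)
    (hα : SplitsWithRoots (pullbackPoly p f) α) : Finite (GaloisGroup p α) := by
  choose τ hτ using exists_perm_of_galoisGroup (p := p) hf hα
  refine Finite.of_injective τ fun φ ψ h => ?_
  have : φ.toAlgHom = ψ.toAlgHom :=
    rootRing_algHom_ext fun i => (hτ φ i).trans (by rw [h]; exact (hτ ψ i).symm)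
  exact AlgEquiv.ext fun s => DFunLike.congr_fun this s

variable [PathConnectedSpace X]

/-- The square of `Δ` descends to the base. -/
theorem exists_pullback_eq_det_sq (hf : IsWeierstrass f n) (hp : IsCoveringMap p)
    (hα : SplitsWithRoots (pullbackPoly p f) α) :
    ∃ D : C(X, ℂ), ∀ y, D (p y) = Delta α y ^ 2 := by
  obtain ⟨D, hD⟩ := mem_pullbackRing_of_constant_on_fibers hp
    ((vMatrix (rootRingGen p α)).det ^ 2 : rootRing p α) fun y y' hy => by
      obtain ⟨σ, -, hσ⟩ := exists_isMonodromy hf hp hα hy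
      rw [← rootRingEval_apply, ← rootRingEval_apply, map_pow, map_pow,
        rootRingEval_det_vMatrix, rootRingEval_det_vMatrix, Delta, Delta,
        ← det_vMatrix_comp_perm_sq (fun i => α i y') σ]
      simp only [hσ]
  refine ⟨D, fun y => (ContinuousMap.congr_fun hD y).trans ?_⟩
  rw [← rootRingEval_apply, map_pow, rootRingEval_det_vMatrix]

theorem isUnit_det_vMatrix (hf : IsWeierstrass f n) (hp : IsCoveringMap p)
    (hα : SplitsWithRoots (pullbackPoly p f) α) : IsUnit (vMatrix (rootRingGen p α)).det := by
  obtain ⟨D, hD⟩ := exists_pullback_eq_det_sq hf hp hα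
  have hD0 (x : X) : D x ≠ 0 := by
    obtain ⟨y, rfl⟩ := surjective_of_isCoveringMap hp x
    rw [hD]
    exact pow_ne_zero _ (det_vMatrix_ne_zero (hα.apply_injective (hf.pullbackPoly p) y))
  let D' : C(X, ℂ) := ⟨fun x => (D x)⁻¹, D.continuous.inv₀ hD0⟩
  refine IsUnit.of_mul_eq_one ((vMatrix (rootRingGen p α)).det * rootRingPullback p α D')
    (rootRing_ext fun y => ?_)
  rw [← rootRingEval_apply, ← mul_assoc, ← sq, map_mul, map_pow, rootRingEval_det_vMatrix, ← hD]
  exact mul_inv_cancel₀ (hD0 (p y))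

theorem isCHRGalois_rootRing (hf : IsWeierstrass f n) (hp : IsCoveringMap p)
    (hα : SplitsWithRoots (pullbackPoly p f) α) :
    IsCHRGalois (pullbackRing p) (rootRing p α) ⊤ where
  injective a b h := Subtype.ext (congrArg (fun s : rootRing p α => (s : C(Y, ℂ))) h)
  finite := have := finite_galoisGroup (p := p) hf hα; inferInstance
  fixed s := by
    constructor
    · intro h
      refine mem_range_algebraMap_iff.mpr
        (mem_pullbackRing_of_constant_on_fibers hp _ fun y y' hy => ?_)
      obtain ⟨σ, hσ, hσ'⟩ := exists_isMonodromy hf hp hα hy.symm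
      obtain ⟨φ, hφ⟩ := hσ.exists_galoisGroup
      rw [← hφ s y y' hy.symm hσ', h φ (Subgroup.mem_top φ)]
    · rintro ⟨r, rfl⟩ φ -
      exact φ.commutes r
  dual := by
    -- The dual elements are column `I₀` of `V⁻¹` and row `I₀` of `V`, where `σ^{I₀} = 1`. An
    -- automorphism inducing `τ` carries this row to the row of `τ`.
    let V := vMatrix (rootRingGen p α)
    have hV : V * V⁻¹ = 1 := Matrix.mul_nonsing_inv V (isUnit_det_vMatrix hf hp hα)
    let e := (Fintype.equivFin (MultiIndex n)).symm
    obtain ⟨I₀, hI₀⟩ := (permOf_bijective n).2 1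
    have hsum (I : MultiIndex n) :
        ∑ j, V⁻¹ (e j) I₀ * V I (e j) = (1 : Matrix (MultiIndex n) (MultiIndex n) _) I I₀ := by
      rw [← hV, Matrix.mul_apply, ← e.sum_comp]
      exact Finset.sum_congr rfl fun j _ => mul_comm _ _
    refine ⟨Fintype.card (MultiIndex n), fun j => V⁻¹ (e j) I₀, fun j => V I₀ (e j), ?_, ?_⟩
    · rw [hsum, Matrix.one_apply_eq]
    · intro φ _ hφ
      obtain ⟨τ, hτ⟩ := exists_perm_of_galoisGroup hf hα φ
      obtain ⟨I, hI⟩ := (permOf_bijective n).2 τ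
      have hφV (J : MultiIndex n) : φ (V I₀ J) = V I J := by
        simp [V, vMatrix, hI₀, hI, hτ]
      simp only [hφV, hsum]
      refine Matrix.one_apply_ne fun h => hφ ?_
      have h1 : τ = 1 := by rw [← hI, h, hI₀]
      have : φ.toAlgHom = AlgHom.id _ _ := rootRing_algHom_ext fun i => by
        have := hτ i
        rwa [h1] at this
      exact AlgEquiv.ext fun s => DFunLike.congr_fun this s

/-- Every automorphism of `R[α_1, …, α_n]` over `R` permutes the roots by a monodromy
permutation. -/
theorem isMonodromy_of_galoisGroup (hf : IsWeierstrass f n) (hp : IsCoveringMap p)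
    (hα : SplitsWithRoots (pullbackPoly p f) α) {φ : GaloisGroup p α} {τ : Equiv.Perm (Fin n)}
    (hτ : ∀ i, φ (rootRingGen p α i) = rootRingGen p α (τ i)) : IsMonodromy p α τ := by
  classical
  obtain ⟨y₀⟩ := (inferInstance : Nonempty Y)
  let V := vMatrix fun i => α i y₀
  have hV : V * V⁻¹ = 1 := Matrix.mul_nonsing_inv V
    (det_vMatrix_ne_zero (hα.apply_injective (hf.pullbackPoly p) y₀)).isUnit
  obtain ⟨I₀, hI₀⟩ := (permOf_bijective n).2 1
  -- Constant coefficients from the inverse matrix at `y₀` make `θ σ` equal to `1` at `y₀` for `σ =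
  -- 1` and `0` otherwise.
  let θ (σ : Equiv.Perm (Fin n)) : rootRing p α := ∑ J : MultiIndex n,
    rootRingPullback p α (ContinuousMap.const X (V⁻¹ J I₀)) *
      ∏ k, rootRingGen p α (σ k) ^ (J k : ℕ)
  have hθeval (σ : Equiv.Perm (Fin n)) (y : Y) : rootRingEval p α y (θ σ) =
      ∑ J : MultiIndex n, V⁻¹ J I₀ * ∏ k, α (σ k) y ^ (J k : ℕ) := by
    simp only [θ, map_sum, map_mul, map_prod, map_pow]
    rfl
  have hθ₀ (σ : Equiv.Perm (Fin n)) : rootRingEval p α y₀ (θ σ) = if σ = 1 then 1 else 0 := by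
    obtain ⟨I, rfl⟩ := (permOf_bijective n).2 σ
    rw [hθeval, ← hI₀]
    simp only [(permOf_injective n).eq_iff]
    rw [← Matrix.one_apply, ← hV, Matrix.mul_apply]
    exact Finset.sum_congr rfl fun J _ => mul_comm _ _
  have hφθ (σ : Equiv.Perm (Fin n)) : φ (θ σ) = θ (τ * σ) := by
    simp only [θ, map_sum, map_mul, map_prod, map_pow, hτ, Equiv.Perm.mul_apply]
    refine Finset.sum_congr rfl fun J _ => ?_
    congr 1
    exact φ.commutes _
  let H := Finset.univ.filter fun σ : Equiv.Perm (Fin n) => IsMonodromy p α σ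
  -- Moving within a fibre translates the summation over the group `H` by an element of `H`, so the
  -- sum descends to `X` and `φ` fixes it.
  have hN : φ (∑ σ ∈ H, θ σ) = ∑ σ ∈ H, θ σ := by
    obtain ⟨r, hr⟩ := mem_range_algebraMap_iff.mpr
      (mem_pullbackRing_of_constant_on_fibers hp (∑ σ ∈ H, θ σ : rootRing p α) fun y y' hy => by
        obtain ⟨ρ, hρ, hρ'⟩ := exists_isMonodromy hf hp hα hy
        rw [← rootRingEval_apply, ← rootRingEval_apply, map_sum, map_sum]
        refine Finset.sum_bij (fun σ _ => ρ * σ) (fun σ hσ => ?_) (fun _ _ _ _ h => mul_left_cancel h)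
          (fun σ hσ => ⟨ρ⁻¹ * σ, ?_, mul_inv_cancel_left ρ σ⟩) fun σ _ => ?_
        · exact Finset.mem_filter.mpr ⟨Finset.mem_univ _, hρ.mul (Finset.mem_filter.mp hσ).2⟩
        · exact Finset.mem_filter.mpr ⟨Finset.mem_univ _, hρ.inv.mul (Finset.mem_filter.mp hσ).2⟩
        · simp only [hθeval, hρ', Equiv.Perm.mul_apply])
    rw [← hr]
    exact φ.commutes r
  have hsum := congrArg (rootRingEval p α y₀) hN
  simp only [map_sum, hφθ, hθ₀] at hsum
  rw [Finset.sum_ite_eq' H 1, if_pos (Finset.mem_filter.mpr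
    ⟨Finset.mem_univ _, isMonodromy_one p α⟩)] at hsum
  -- At `y₀` the sum over `H` is `1`, so its image, the sum of the `θ (τ * σ)`, has a nonzero term
  -- there, which forces `τ = σ⁻¹` with `σ ∈ H`.
  obtain ⟨σ, hσ, hne⟩ := Finset.exists_ne_zero_of_sum_ne_zero (hsum.trans_ne one_ne_zero)
  have h1 : τ * σ = 1 := by
    by_contra h
    exact hne (if_neg h)
  rw [eq_inv_of_mul_eq_one_left h1]
  exact (Finset.mem_filter.mp hσ).2.inv

end RootRing

/-! ### The covering by ordered roots. -/

section RootImage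

variable {X Y : Type*} [TopologicalSpace X] [TopologicalSpace Y] {n : ℕ}

/-- The map `y ↦ (p y, (α_1 y, …, α_n y))`. -/
noncomputable def rootMap (p : C(Y, X)) (α : Fin n → C(Y, ℂ)) : C(Y, X × (Fin n → ℂ)) :=
  p.prodMk (ContinuousMap.pi α)

/-- The image of `Y` in the space of orderings of the roots, a covering space of `X`. -/
abbrev RootImage (p : C(Y, X)) (α : Fin n → C(Y, ℂ)) : Type _ :=
  Set.range (rootMap p α)

/-- The projection of `RootImage p α` to `X`. -/
def rootImageProj (p : C(Y, X)) (α : Fin n → C(Y, ℂ)) : C(RootImage p α, X) :=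
  ⟨fun z => z.1.1, by fun_prop⟩

/-- The tautological roots on `RootImage p α`. -/
def rootImageCoord (p : C(Y, X)) (α : Fin n → C(Y, ℂ)) (i : Fin n) : C(RootImage p α, ℂ) :=
  ⟨fun z => z.1.2 i, by fun_prop⟩

/-- The map `Y → RootImage p α`. -/
noncomputable def toRootImage (p : C(Y, X)) (α : Fin n → C(Y, ℂ)) : C(Y, RootImage p α) :=
  ⟨fun y => ⟨rootMap p α y, y, rfl⟩, by fun_prop⟩

variable {p : C(Y, X)} {α : Fin n → C(Y, ℂ)} {f : C(X, ℂ)[X]}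

theorem rootImage_ext {z z' : RootImage p α} (h : rootImageProj p α z = rootImageProj p α z')
    (h' : ∀ i, rootImageCoord p α i z = rootImageCoord p α i z') : z = z' :=
  Subtype.ext (Prod.ext h (funext h'))

theorem toRootImage_surjective : Function.Surjective (toRootImage p α) := by
  rintro ⟨_, y, rfl⟩
  exact ⟨y, rfl⟩

instance [PathConnectedSpace Y] : PathConnectedSpace (RootImage p α) :=
  isPathConnected_iff_pathConnectedSpace.mp (isPathConnected_range (rootMap p α).continuous)

theorem splitsWithRoots_rootImageCoord (hα : SplitsWithRoots (pullbackPoly p f) α) :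
    SplitsWithRoots (pullbackPoly (rootImageProj p α) f) (rootImageCoord p α) := by
  refine ⟨fun i j h => hα.1 (ContinuousMap.ext fun y => ?_), fun i => ?_⟩
  · exact ContinuousMap.congr_fun h (toRootImage p α y)
  · rw [isContRoot_pullbackPoly]
    rintro ⟨_, y, rfl⟩
    exact isContRoot_pullbackPoly.mp (hα.2 i) y

variable [PathConnectedSpace X] [PathConnectedSpace Y]

/-- Over the domain of a local section `s` of `p`, each point is a unique monodromy relabelling of
the roots at `s x`. The finite set of monodromy permutations thus serves as the fibre. -/
theorem isCoveringMap_rootImageProj (hf : IsWeierstrass f n) (hp : IsCoveringMap p)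
    (hα : SplitsWithRoots (pullbackPoly p f) α) : IsCoveringMap (rootImageProj p α) := by
  intro x₀
  obtain ⟨y₀, rfl⟩ := surjective_of_isCoveringMap hp x₀
  let s := hp.isLocalHomeomorph.localInverseAt y₀
  have hs (x : X) (hx : x ∈ s.source) : p (s x) = x :=
    hp.isLocalHomeomorph.apply_localInverseAt_of_mem hx
  let I := {σ : Equiv.Perm (Fin n) // IsMonodromy p α σ}
  let _ : TopologicalSpace I := ⊥
  have : DiscreteTopology I := ⟨rfl⟩
  let W := rootImageProj p α ⁻¹' s.source
  have hW (z : W) : z.1.1.1 ∈ s.source := z.2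
  have hex (z : W) : ∃ σ : I, ∀ i, z.1.1.2 i = α (σ.1 i) (s z.1.1.1) := by
    obtain ⟨⟨_, y, rfl⟩, hz⟩ := z
    obtain ⟨σ, hσ, h⟩ := exists_isMonodromy hf hp hα (hs (p y) hz).symm
    exact ⟨⟨σ, hσ⟩, h⟩
  choose t ht using hex
  have ht_iff (z : W) (σ : I) : t z = σ ↔ ∀ i, z.1.1.2 i = α (σ.1 i) (s z.1.1.1) := by
    refine ⟨fun h => h ▸ ht z, fun h => Subtype.ext (Equiv.ext fun i => ?_)⟩
    exact hα.apply_injective (hf.pullbackPoly p) (s z.1.1.1) ((ht z i).symm.trans (h i))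
  have hscont : Continuous fun z : W => s z.1.1.1 :=
    s.continuousOn.comp_continuous (by fun_prop) hW
  -- Each label is cut out by closed conditions, and there are finitely many labels.
  have htcont : Continuous t := by
    refine continuous_iff_isClosed.mpr fun C _ => ?_
    have hC : t ⁻¹' C = ⋃ σ ∈ C, {z | t z = σ} := by
      ext z
      simp
    rw [hC]
    refine (Set.toFinite C).isClosed_biUnion fun σ _ => ?_
    simp only [ht_iff, Set.ofPred_forall]
    exact isClosed_iInter fun i =>
      isClosed_eq (by fun_prop) ((α (σ.1 i)).continuous.comp hscont)
  have hmem (u : s.source × I) :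
      ((u.1 : X), fun i => α (u.2.1 i) (s u.1)) ∈ Set.range (rootMap p α) := by
    obtain ⟨y, hy, hy'⟩ := u.2.2 (s u.1)
    exact ⟨y, Prod.ext (hy.trans (hs _ u.1.2)) (funext hy')⟩
  have hscont' : Continuous fun u : s.source × I => s u.1 :=
    s.continuousOn.comp_continuous (by fun_prop) fun u => u.1.2
  refine IsEvenlyCovered.to_isEvenlyCovered_preimage (I := I) ⟨inferInstance, s.source,
    hp.isLocalHomeomorph.apply_self_mem_localInverseAt_source, s.open_source,
    s.open_source.preimage (rootImageProj p α).continuous,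
    { toFun := fun z => (⟨z.1.1.1, hW z⟩, t z)
      invFun := fun u => ⟨⟨_, hmem u⟩, u.1.2⟩
      left_inv := fun z => Subtype.ext (Subtype.ext (Prod.ext rfl (funext fun i => (ht z i).symm)))
      right_inv := fun u => Prod.ext rfl ((ht_iff _ _).mpr fun i => rfl)
      continuous_toFun := by fun_prop
      continuous_invFun := by
        refine Continuous.subtype_mk (Continuous.subtype_mk (Continuous.prodMk (by fun_prop)
          (continuous_pi fun i => ?_)) _) _
        refine continuous_prod_of_discrete_right.mpr fun σ => ?_
        exact (α (σ.1 i)).continuous.comp (hscont'.comp (by fun_prop : Continuous fun x => (x, σ))) },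
    fun z => rfl⟩

end RootImage

/-! ### Minimality and covering transformations. -/

section SplittingCoverings

variable {X E : Type u} [TopologicalSpace X] [TopologicalSpace E] [PathConnectedSpace X] {n : ℕ}
  {f : C(X, ℂ)[X]} {q : C(E, X)} {β : Fin n → C(E, ℂ)}

/-- A point of a splitting covering is determined by its image and the values of the roots. -/
theorem IsSplittingCovering.toRootImage_bijective (hq : IsSplittingCovering f n q)
    (hf : IsWeierstrass f n) (hβ : SplitsWithRoots (pullbackPoly q f) β) :
    Function.Bijective (toRootImage q β) := by
  have := hq.pathConnected
  refine ⟨?_, toRootImage_surjective⟩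
  have hsplit := splitsWithRoots_rootImageCoord hβ
  -- Minimality gives a surjection `π` back to `E`. The roots pulled back along `π` are the
  -- coordinates up to order, so the base point and root values of `π z` determine `z`.
  obtain ⟨π, hπ, hqπ⟩ := hq.smallest (RootImage q β) (rootImageProj q β)
    (isCoveringMap_rootImageProj hf hq.isCoveringMap hβ) ⟨_, hsplit⟩
  have hqπ' (z : RootImage q β) : q (π z) = rootImageProj q β z := ContinuousMap.congr_fun hqπ z
  have hβπ := hβ.comp_of_surjective (surjective_of_isCoveringMap hπ) hqπ
  obtain ⟨τ, hτ⟩ := hsplit.exists_perm (hf.pullbackPoly _) hβπ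
  have hτ' (i : Fin n) (z : RootImage q β) : rootImageCoord q β i z = β (τ.symm i) (π z) := by
    simpa using (ContinuousMap.congr_fun (hτ (τ.symm i)) z).symm
  intro e e' h
  obtain ⟨z, rfl⟩ := surjective_of_isCoveringMap hπ e
  obtain ⟨z', rfl⟩ := surjective_of_isCoveringMap hπ e'
  congr 1
  refine rootImage_ext ?_ fun i => ?_
  · rw [← hqπ', ← hqπ']
    exact congrArg (rootImageProj q β) h
  · rw [hτ', hτ']
    exact congrArg (rootImageCoord q β (τ.symm i)) h

/-- Every monodromy permutation of the roots on a splitting covering is induced by a covering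
transformation. -/
theorem IsSplittingCovering.exists_coveringTransformation (hq : IsSplittingCovering f n q)
    (hf : IsWeierstrass f n) (hβ : SplitsWithRoots (pullbackPoly q f) β)
    {σ : Equiv.Perm (Fin n)} (hσ : IsMonodromy q β σ) :
    ∃ Φ ∈ coveringTransformations q, ∀ i e, β i (Φ e) = β (σ i) e := by
  have := hq.pathConnected
  have hlocal : IsLocalHomeomorph (toRootImage q β) :=
    .of_comp (g := rootImageProj q β) (hgf := hq.isCoveringMap.isLocalHomeomorph)
      (hg := (isCoveringMap_rootImageProj hf hq.isCoveringMap hβ).isLocalHomeomorph)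
      (toRootImage q β).continuous
  let g := hlocal.toHomeomorphOfBijective (hq.toRootImage_bijective hf hβ)
  have hmem {ρ : Equiv.Perm (Fin n)} (hρ : IsMonodromy q β ρ) (z : RootImage q β) :
      (z.1.1, fun i => z.1.2 (ρ i)) ∈ Set.range (rootMap q β) := by
    obtain ⟨_, e, rfl⟩ := z
    obtain ⟨e', h1, h2⟩ := hρ e
    exact ⟨e', Prod.ext h1 (funext h2)⟩
  -- Permuting coordinates preserves the image because `σ` and `σ⁻¹` are both monodromy; conjugation
  -- by `g` moves this to `E`.
  let T : RootImage q β ≃ₜ RootImage q β :=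
    { toFun := fun z => ⟨_, hmem hσ z⟩
      invFun := fun z => ⟨_, hmem hσ.inv z⟩
      left_inv := fun z => rootImage_ext rfl fun i => congrArg z.1.2 (σ.apply_symm_apply i)
      right_inv := fun z => rootImage_ext rfl fun i => congrArg z.1.2 (σ.symm_apply_apply i)
      continuous_toFun := by fun_prop
      continuous_invFun := by fun_prop }
  have hT (e : E) : g ((g.trans T).trans g.symm e) = T (g e) := g.apply_symm_apply _
  exact ⟨(g.trans T).trans g.symm, fun e => congrArg (rootImageProj q β) (hT e),
    fun i e => congrArg (rootImageCoord q β i) (hT e)⟩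

end SplittingCoverings

/-! ### Conjugation across different ground rings. -/

section Conjugation

variable {A B S T : Type*} [CommSemiring A] [CommSemiring B] [Semiring S] [Semiring T] [Algebra A S]
  [Algebra B T]

/-- Conjugation of algebra automorphisms by a ring isomorphism that respects the ground rings. -/
def conjAlgEquiv (Θ : S ≃+* T) (h : ∀ s, Θ s ∈ Set.range (algebraMap B T) →
    s ∈ Set.range (algebraMap A S)) (φ : S ≃ₐ[A] S) : T ≃ₐ[B] T :=
  AlgEquiv.ofRingEquiv (f := (Θ.symm.trans φ.toRingEquiv).trans Θ) fun b => by
    obtain ⟨a, ha⟩ := h (Θ.symm (algebraMap B T b)) (by simp)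
    change Θ (φ (Θ.symm (algebraMap B T b))) = algebraMap B T b
    rw [← ha, φ.commutes, ha, Θ.apply_symm_apply]

/-- Conjugation by a ring isomorphism that respects the ground rings, as an isomorphism of the
automorphism groups. -/
def conjMulEquiv (Θ : S ≃+* T) (h : ∀ s, Θ s ∈ Set.range (algebraMap B T) ↔
    s ∈ Set.range (algebraMap A S)) : (S ≃ₐ[A] S) ≃* (T ≃ₐ[B] T) where
  toFun := conjAlgEquiv Θ fun s => (h s).mp
  invFun := conjAlgEquiv Θ.symm fun t ht => by simpa using (h (Θ.symm t)).mpr ht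
  left_inv φ := AlgEquiv.ext fun s => by simp [conjAlgEquiv]
  right_inv φ := AlgEquiv.ext fun s => by simp [conjAlgEquiv]
  map_mul' φ ψ := AlgEquiv.ext fun s => by simp [conjAlgEquiv]

theorem conjMulEquiv_apply (Θ : S ≃+* T) (h : ∀ s, Θ s ∈ Set.range (algebraMap B T) ↔
    s ∈ Set.range (algebraMap A S)) (φ : S ≃ₐ[A] S) (s : S) :
    conjMulEquiv Θ h φ (Θ s) = Θ (φ s) :=
  congrArg (fun t => Θ (φ t)) (Θ.symm_apply_apply s)

end Conjugation

/-! ### Comparing the rings of roots on two coverings. -/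

section Comparison

variable {X Y E : Type*} [TopologicalSpace X] [TopologicalSpace Y] [TopologicalSpace E] {n : ℕ}
  {p : C(Y, X)} {q : C(E, X)} {α : Fin n → C(Y, ℂ)} {β : Fin n → C(E, ℂ)}

/-- Composition with a surjective map over `X` that carries roots to roots is an isomorphism of
the rings of roots. -/
theorem exists_rootRing_equiv {π : C(Y, E)} (hπ : Function.Surjective π) (hq : q.comp π = p)
    {τ : Equiv.Perm (Fin n)} (hτ : ∀ i, (β i).comp π = α (τ i)) :
    ∃ Θ : rootRing q β ≃+* rootRing p α, ∀ s, (Θ s : C(Y, ℂ)) = (s : C(E, ℂ)).comp π := by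
  subst hq
  have hmem (s : rootRing q β) : pullback π s ∈ rootRing (q.comp π) α := by
    obtain ⟨s, hs⟩ := s
    change pullback π s ∈ _
    induction hs using Algebra.adjoin_induction with
    | mem _ h =>
      obtain ⟨i, rfl⟩ := h
      exact Algebra.subset_adjoin ⟨τ i, (hτ i).symm⟩
    | algebraMap r =>
      obtain ⟨_, γ, rfl⟩ := r
      exact (rootRingPullback (q.comp π) α γ).2
    | add _ _ _ _ h₁ h₂ => rw [map_add]; exact add_mem h₁ h₂
    | mul _ _ _ _ h₁ h₂ => rw [map_mul]; exact mul_mem h₁ h₂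
  let θ : rootRing q β →+* rootRing (q.comp π) α :=
    ((pullback π).comp (rootRing q β).val.toRingHom).codRestrict (rootRing (q.comp π) α) hmem
  refine ⟨RingEquiv.ofBijective θ ⟨fun s t h => rootRing_ext fun e => ?_, ?_⟩, fun s => rfl⟩
  · obtain ⟨y, rfl⟩ := hπ e
    exact ContinuousMap.congr_fun (congrArg Subtype.val h) y
  · rintro ⟨t, ht⟩
    suffices ∃ s : rootRing q β, pullback π s = t from
      this.imp fun s hs => Subtype.ext hs
    induction ht using Algebra.adjoin_induction with
    | mem _ h =>
      obtain ⟨i, rfl⟩ := h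
      exact ⟨rootRingGen q β (τ.symm i), (hτ _).trans (by rw [τ.apply_symm_apply])⟩
    | algebraMap r =>
      obtain ⟨_, γ, rfl⟩ := r
      exact ⟨rootRingPullback q β γ, rfl⟩
    | add _ _ _ _ h₁ h₂ =>
      obtain ⟨s₁, rfl⟩ := h₁
      obtain ⟨s₂, rfl⟩ := h₂
      exact ⟨s₁ + s₂, map_add (pullback π) _ _⟩
    | mul _ _ _ _ h₁ h₂ =>
      obtain ⟨s₁, rfl⟩ := h₁
      obtain ⟨s₂, rfl⟩ := h₂
      exact ⟨s₁ * s₂, map_mul (pullback π) _ _⟩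

theorem mem_range_algebraMap_iff_of_comp {π : C(Y, E)} (hπ : Function.Surjective π)
    (hq : q.comp π = p) {s : rootRing q β} {t : rootRing p α}
    (h : (t : C(Y, ℂ)) = (s : C(E, ℂ)).comp π) :
    t ∈ Set.range (algebraMap (pullbackRing p) (rootRing p α)) ↔
      s ∈ Set.range (algebraMap (pullbackRing q) (rootRing q β)) := by
  subst hq
  rw [mem_range_algebraMap_iff, mem_range_algebraMap_iff, h]
  refine exists_congr fun γ => ⟨fun hγ => ?_, fun hγ => hγ ▸ rfl⟩
  ext e
  obtain ⟨y, rfl⟩ := hπ e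
  exact ContinuousMap.congr_fun hγ y

end Comparison

/-! ### The action of covering transformations. -/

section CoveringTransformations

variable {X E : Type*} [TopologicalSpace X] [TopologicalSpace E] [PathConnectedSpace E] {n : ℕ}
  {f : C(X, ℂ)[X]} {q : C(E, X)} {β : Fin n → C(E, ℂ)}

/-- A covering transformation acts on the ring of roots. -/
theorem exists_galoisGroup_of_coveringTransformation (hf : IsWeierstrass f n)
    (hβ : SplitsWithRoots (pullbackPoly q f) β) (Φ : coveringTransformations q) :
    ∃ φ : GaloisGroup q β, ∀ s e, (φ s : C(E, ℂ)) e = (s : C(E, ℂ)) ((Φ : E ≃ₜ E)⁻¹ e) := by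
  let Ψ : E ≃ₜ E := (Φ : E ≃ₜ E)⁻¹
  have hΨ (e : E) : q (Ψ e) = q e := (Φ⁻¹).2 e
  have hsplit := hβ.comp_of_surjective (π := (Ψ : C(E, E))) Ψ.surjective (ContinuousMap.ext hΨ)
  obtain ⟨τ, hτ⟩ := hβ.exists_perm (hf.pullbackPoly q) hsplit
  have hτ' (e : E) (i : Fin n) : β i (Ψ e) = β (τ i) e := ContinuousMap.congr_fun (hτ i) e
  obtain ⟨φ, hφ⟩ := IsMonodromy.exists_galoisGroup fun e => ⟨Ψ e, hΨ e, hτ' e⟩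
  exact ⟨φ, fun s e => hφ s e (Ψ e) (hΨ e) (hτ' e)⟩

end CoveringTransformations

end SemiTopGalois

/-! ### The main theorem. -/

theorem mainTheorem2 {X : Type u} [TopologicalSpace X] [PathConnectedSpace X]
    [LocallyPathConnectedSpace X]
    {n : ℕ} (f : Polynomial C(X, ℂ)) (hf : SemiTopGalois.IsWeierstrass f n) :
    (∀ (Y : Type u) [TopologicalSpace Y] [PathConnectedSpace Y] (p : C(Y, X)),
      IsCoveringMap p → ∀ α : Fin n → C(Y, ℂ),
      SemiTopGalois.SplitsWithRoots (SemiTopGalois.pullbackPoly p f) α →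
        -- `1 / Δ` lies in `R[α_1, …, α_n]`
        (∃ g ∈ SemiTopGalois.rootRing p α, ∀ y, SemiTopGalois.Delta α y * g y = 1) ∧
        -- `R[α_1, …, α_n]` is Galois over `R` with group all of `Aut_R(R[α_1, …, α_n])`
        SemiTopGalois.IsCHRGalois (SemiTopGalois.pullbackRing p) (SemiTopGalois.rootRing p α) ⊤ ∧
        -- and this group is `G_f`, by conjugation with an isomorphism of the rings of roots
        ∀ (E : Type u) [TopologicalSpace E] (q : C(E, X)),
          SemiTopGalois.IsSplittingCovering f n q → ∀ β : Fin n → C(E, ℂ),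
          SemiTopGalois.SplitsWithRoots (SemiTopGalois.pullbackPoly q f) β →
          ∃ (Θ : SemiTopGalois.rootRing q β ≃+* SemiTopGalois.rootRing p α)
            (ι : SemiTopGalois.GaloisGroup q β ≃* SemiTopGalois.GaloisGroup p α),
            (∀ (s : SemiTopGalois.rootRing q β) (γ : C(X, ℂ)),
              (s : C(E, ℂ)) = γ.comp q → (Θ s : C(Y, ℂ)) = γ.comp p) ∧
            (∃ τ : Equiv.Perm (Fin n), ∀ (s : SemiTopGalois.rootRing q β) (i : Fin n),
              (s : C(E, ℂ)) = β i → (Θ s : C(Y, ℂ)) = α (τ i)) ∧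
            ∀ φ s, ι φ (Θ s) = Θ (φ s)) ∧
    -- `ω : A(E_f/X) → G_f`, `ω(Φ)(s) = s ∘ Φ⁻¹`, is a surjective homomorphism
    (∀ (E : Type u) [TopologicalSpace E] (q : C(E, X)),
      SemiTopGalois.IsSplittingCovering f n q → ∀ β : Fin n → C(E, ℂ),
      SemiTopGalois.SplitsWithRoots (SemiTopGalois.pullbackPoly q f) β →
      ∃ ω : SemiTopGalois.coveringTransformations q →* SemiTopGalois.GaloisGroup q β,
        (∀ (Φ : SemiTopGalois.coveringTransformations q) (s : SemiTopGalois.rootRing q β) (e : E),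
          (ω Φ s : C(E, ℂ)) e = (s : C(E, ℂ)) ((Φ : E ≃ₜ E)⁻¹ e)) ∧
        Function.Surjective ω) := by
  refine ⟨fun Y _ _ p hp α hα => ⟨?_, SemiTopGalois.isCHRGalois_rootRing hf hp hα,
    fun E _ q hq β hβ => ?_⟩, fun E _ q hq β hβ => ?_⟩
  · obtain ⟨g, hg⟩ := (SemiTopGalois.isUnit_det_vMatrix hf hp hα).exists_right_inv
    refine ⟨g, g.2, fun y => ?_⟩
    have h := congrArg (SemiTopGalois.rootRingEval p α y) hg
    rwa [map_mul, map_one, SemiTopGalois.rootRingEval_det_vMatrix] at h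
  · have := hq.pathConnected
    obtain ⟨π, hπ, hqπ⟩ := hq.smallest Y p hp ⟨α, hα⟩
    have hsurj := SemiTopGalois.surjective_of_isCoveringMap hπ
    have hβπ := hβ.comp_of_surjective hsurj hqπ
    obtain ⟨τ, hτ⟩ := hα.exists_perm (hf.pullbackPoly p) hβπ
    obtain ⟨Θ, hΘ⟩ := SemiTopGalois.exists_rootRing_equiv hsurj hqπ hτ
    have hrange (s : SemiTopGalois.rootRing q β) :=
      SemiTopGalois.mem_range_algebraMap_iff_of_comp hsurj hqπ (hΘ s)
    refine ⟨Θ, SemiTopGalois.conjMulEquiv Θ hrange, fun s γ hs => ?_,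
      ⟨τ, fun s i hs => ?_⟩, fun φ s => ?_⟩
    · rw [hΘ, hs, ← hqπ, ContinuousMap.comp_assoc]
    · rw [hΘ, hs, hτ]
    · exact SemiTopGalois.conjMulEquiv_apply Θ _ φ s
  · have := hq.pathConnected
    choose ω hω using SemiTopGalois.exists_galoisGroup_of_coveringTransformation (q := q) hf hβ
    refine ⟨MonoidHom.mk' ω fun Φ Ψ => AlgEquiv.ext fun s =>
      SemiTopGalois.rootRing_ext fun e => ?_, hω, fun φ => ?_⟩
    · rw [hω, AlgEquiv.mul_apply, hω, hω, Subgroup.coe_mul, mul_inv_rev]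
      rfl
    · obtain ⟨τ, hτ⟩ := SemiTopGalois.exists_perm_of_galoisGroup hf hβ φ
      obtain ⟨Φ, hΦ, hβΦ⟩ := hq.exists_coveringTransformation hf hβ
        (SemiTopGalois.isMonodromy_of_galoisGroup hf hq.isCoveringMap hβ hτ)
      -- `Φ` satisfies `β i (Φ e) = β (τ i) e`, while `ω` composes with the inverse, so the preimage
      -- of `φ` is `Φ⁻¹`.
      refine ⟨⟨Φ, hΦ⟩⁻¹, ?_⟩
      have heq : (ω ⟨Φ, hΦ⟩⁻¹).toAlgHom = φ.toAlgHom :=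
        SemiTopGalois.rootRing_algHom_ext fun i => SemiTopGalois.rootRing_ext fun e => by
          refine (hω ⟨Φ, hΦ⟩⁻¹ _ e).trans ?_
          refine Eq.trans ?_ (ContinuousMap.congr_fun (congrArg Subtype.val (hτ i)) e).symm
          rw [InvMemClass.coe_inv, inv_inv]
          exact hβΦ i e
      exact AlgEquiv.ext fun s => DFunLike.congr_fun heq s
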